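/- For every finite simple graph $\Gamma$ (no loops, no multiple edges) with vertex set $V_\Gamma$, let $A_\Gamma$ be the right-angled Artin group with one generator $g_v$ for each vertex $v$ and one relation $g_vg_w=g_wg_v$ for each pair of adjacent vertices $v,w$. For $n\ge 1$ let $nV$ be the Brin–Thompson group: the group, under composition, of all homeomorphisms $h$ of the Cantor cube $(\{0,1\}^\omega)^n$ for which there are two partitions $D_1,\dots,D_k$ and $R_1,\dots,R_k$ of the cube into finitely many subcubes such that $h$ maps each $D_i$ onto $R_i$ by prefix replacement $(\alpha_1x_1,\dots,\alpha_nx_n)\mapsto(\beta_1x_1,\dots,\beta_nx_n)$. (A subcube is the set of all points whose $i$-th coordinate begins with $\alpha_i$ for every $i$, for given finite binary words $\alpha_1,\dots,\alpha_n$.) Then for every finite simple graph $\Gamma$ there exists an $n\ge 1$ such that the standard restricted wreath product $$nV\wr A_\Gamma=\Bigl(\bigoplus_{A_\Gamma} nV\Bigr)\rtimes A_\Gamma$$ embeds into $nV$, that is, there is an injective group homomorphism $nV\wr A_\Gamma\to nV$. Here $\bigoplus_{A_\Gamma} nV$ is the group of finitely supported functions $A_\Gamma\to nV$ under pointwise multiplication,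 and $A_\Gamma$ acts on it by left translation, $(g\cdot f)(x)=f(g^{-1}x)$. -/

import Mathlib

/-! ### Right-angled Artin groups -/

/-- The right-angled Artin group of a graph: one generator for each vertex, and the relation that
`v` and `w` commute (their commutator is trivial) for each pair of adjacent vertices `v`, `w`. -/
abbrev RightAngledArtinGroup {V : Type*} (Γ : SimpleGraph V) : Type _ :=
  PresentedGroup {r : FreeGroup V | ∃ v w : V, Γ.Adj v w ∧
    r = FreeGroup.of v * FreeGroup.of w * (FreeGroup.of v)⁻¹ * (FreeGroup.of w)⁻¹}

/-! ### Restricted wreath products -/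

/-- The direct sum `⨁_{x ∈ G} H` of copies of a (not necessarily commutative) group `H`: the
functions `G → H` with finite support, under pointwise multiplication. -/
def directPower (G H : Type*) [Group H] : Subgroup (G → H) where
  carrier := {f | (Function.mulSupport f).Finite}
  one_mem' := by simp
  mul_mem' ha hb := (ha.union hb).subset (Function.mulSupport_mul _ _)
  inv_mem' ha := by simpa using ha

/-- Translation by an element `g` of `G` on the direct sum: `(g • f) x = f (g⁻¹ * x)`. -/
def directPower.translate {G H : Type*} [Group G] [Group H] (g : G) (f : directPower G H) :
    directPower G H :=
  ⟨fun x => f.1 (g⁻¹ * x), by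
    have h : (Function.mulSupport f.1).Finite := f.2
    exact h.preimage (mul_right_injective g⁻¹).injOn⟩

/-- The action of `G` on the direct sum `⨁_{x ∈ G} H` by left translation of the index set. -/
def directPower.shift (G H : Type*) [Group G] [Group H] : G →* MulAut (directPower G H) where
  toFun g :=
    { toFun := directPower.translate g
      invFun := directPower.translate g⁻¹
      left_inv := fun f => Subtype.ext (funext fun x => by simp [directPower.translate])
      right_inv := fun f => Subtype.ext (funext fun x => by simp [directPower.translate])
      map_mul' := fun _ _ => rfl }
  map_one' := by
    ext f
    simp [directPower.translate]
  map_mul' g h := by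
    refine MulEquiv.ext fun f => Subtype.ext (funext fun x => ?_)
    change f.1 ((g * h)⁻¹ * x) = f.1 (h⁻¹ * (g⁻¹ * x))
    rw [mul_inv_rev, mul_assoc]

/-- The standard restricted wreath product `H ≀ G = (⨁_{x ∈ G} H) ⋊ G`. -/
abbrev RestrictedWreathProduct (H G : Type*) [Group H] [Group G] : Type _ :=
  SemidirectProduct (directPower G H) G (directPower.shift G H)

/-! ### The Brin-Thompson groups -/

/-- Concatenation `w · x` of a finite binary word `w` with an infinite binary sequence `x`. -/
def prependWord (w : List Bool) (x : ℕ → Bool) : ℕ → Bool :=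
  fun k => if h : k < w.length then w[k] else x (k - w.length)

/-- The Cantor cube `({0,1}^ω)^n`, with the product topology. -/
abbrev CantorCube (n : ℕ) : Type := Fin n → ℕ → Bool

/-- The subcube of all points whose `i`-th coordinate begins with the word `α i`, for all `i`. -/
def subcube {n : ℕ} (α : Fin n → List Bool) : Set (CantorCube n) :=
  {x | ∀ i, ∀ k, ∀ h : k < (α i).length, x i k = (α i)[k]}

/-- The canonical map `(x₁, …, xₙ) ↦ (α₁ · x₁, …, αₙ · xₙ)` of the Cantor cube onto the
subcube given by `α`. -/
def prependCube {n : ℕ} (α : Fin n → List Bool) (x : CantorCube n) : CantorCube n :=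
  fun i => prependWord (α i) (x i)

/-- A rearrangement of the Cantor cube: a homeomorphism `h` for which there are two partitions of
the cube into finitely many subcubes, `D j` (given by the words `α j`) and `R j` (given by the
words `β j`), such that `h` maps each `D j` to `R j` by prefix replacement. -/
def IsRearrangement {n : ℕ} (h : CantorCube n ≃ₜ CantorCube n) : Prop :=
  ∃ (J : Type) (_ : Finite J) (α β : J → Fin n → List Bool),
    (∀ x : CantorCube n, ∃! j, x ∈ subcube (α j)) ∧
    (∀ x : CantorCube n, ∃! j, x ∈ subcube (β j)) ∧
    ∀ (j : J) (x : CantorCube n), h (prependCube (α j) x) = prependCube (β j) x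

theorem prependWord_append (u v : List Bool) (x : ℕ → Bool) :
    prependWord (u ++ v) x = prependWord u (prependWord v x) := by
  funext k
  simp only [prependWord, List.length_append]
  by_cases h1 : k < u.length
  · have h2 : k < u.length + v.length := by omega
    simp [h1, h2, List.getElem_append_left]
  · by_cases h2 : k < u.length + v.length
    · have h3 : k - u.length < v.length := by omega
      simp [h1, h2, h3, List.getElem_append_right (not_lt.mp h1)]
    · have h3 : ¬ k - u.length < v.length := by omega
      simp [h1, h2, h3, Nat.sub_sub]

theorem prependCube_append {n : ℕ} (u v : Fin n → List Bool) (x : CantorCube n) :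
    prependCube (fun i => u i ++ v i) x = prependCube u (prependCube v x) :=
  funext fun i => prependWord_append (u i) (v i) (x i)

theorem prependCube_mem {n : ℕ} (u : Fin n → List Bool) (x : CantorCube n) :
    prependCube u x ∈ subcube u := by
  intro i k h
  simp [prependCube, prependWord, h]

theorem mem_subcube_iff {n : ℕ} {u : Fin n → List Bool} {x : CantorCube n} :
    x ∈ subcube u ↔ ∃ y, prependCube u y = x := by
  constructor
  · intro hx
    refine ⟨fun i k => x i (k + (u i).length), ?_⟩
    funext i k
    by_cases h : k < (u i).length
    · simp [prependCube, prependWord, h, hx i k h]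
    · simp [prependCube, prependWord, h, Nat.sub_add_cancel (not_lt.mp h)]
  · rintro ⟨y, rfl⟩
    exact prependCube_mem u y

theorem prependCube_injective {n : ℕ} (u : Fin n → List Bool) :
    Function.Injective (prependCube u) := by
  intro x y h
  funext i k
  have := congrFun (congrFun h i) (k + (u i).length)
  simpa [prependCube, prependWord] using this

theorem append_drop_eq_of_prefix {u v : List Bool} (x : ℕ → Bool)
    (hu : ∀ k, ∀ h : k < u.length, x k = u[k]) (hv : ∀ k, ∀ h : k < v.length, x k = v[k]) :
    u ++ v.drop u.length = v ++ u.drop v.length := by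
  apply List.ext_getElem
  · simp only [List.length_append, List.length_drop]
    omega
  · intro k h1 h2
    simp only [List.length_append, List.length_drop] at h1 h2
    by_cases ku : k < u.length
    · by_cases kv : k < v.length
      · rw [List.getElem_append_left ku, List.getElem_append_left kv, ← hu k ku, ← hv k kv]
      · rw [List.getElem_append_left ku, List.getElem_append_right (not_lt.mp kv),
          List.getElem_drop]
        congr 1
        omega
    · have kv : k < v.length := by omega
      rw [List.getElem_append_left kv, List.getElem_append_right (not_lt.mp ku),
        List.getElem_drop]
      congr 1
      omega

theorem prependCube_mem_iff {n : ℕ} {u v : Fin n → List Bool}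
    (huv : ∀ i, u i ++ (v i).drop (u i).length = v i ++ (u i).drop (v i).length)
    (y : CantorCube n) :
    prependCube u y ∈ subcube v ↔ y ∈ subcube fun i => (v i).drop (u i).length := by
  constructor
  · intro h i k hk
    have hk' : (u i).length + k < (v i).length := by
      simp only [List.length_drop] at hk
      omega
    have := h i ((u i).length + k) hk'
    simpa [prependCube, prependWord] using this
  · intro h
    obtain ⟨z, rfl⟩ := mem_subcube_iff.1 h
    rw [← prependCube_append]
    simp only [huv]
    rw [prependCube_append]
    exact prependCube_mem _ _

theorem IsRearrangement.one {n : ℕ} :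
    IsRearrangement (1 : CantorCube n ≃ₜ CantorCube n) := by
  have h (x : CantorCube n) : x ∈ subcube fun _ : Fin n => ([] : List Bool) := by
    intro i k hk
    simp at hk
  refine ⟨Unit, inferInstance, fun _ _ => [], fun _ _ => [], fun x => ⟨(), h x, fun _ _ => rfl⟩,
    fun x => ⟨(), h x, fun _ _ => rfl⟩, fun _ _ => rfl⟩

theorem IsRearrangement.inv {n : ℕ} {h : CantorCube n ≃ₜ CantorCube n} (H : IsRearrangement h) :
    IsRearrangement h⁻¹ := by
  obtain ⟨J, hJ, α, β, hα, hβ, hh⟩ := H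
  refine ⟨J, hJ, β, α, hβ, hα, fun j x => ?_⟩
  rw [← hh j x]
  exact h.symm_apply_apply _

theorem IsRearrangement.partition_comp {n : ℕ} {h : CantorCube n → CantorCube n}
    {J K : Type} {α β : J → Fin n → List Bool} {γ : K → Fin n → List Bool}
    (hα : ∀ x : CantorCube n, ∃! j, x ∈ subcube (α j))
    (hγ : ∀ x : CantorCube n, ∃! k, x ∈ subcube (γ k))
    (hh : ∀ (j : J) (x : CantorCube n), h (prependCube (α j) x) = prependCube (β j) x)
    (x : CantorCube n) :
    ∃! p : {p : J × K // ∀ i, β p.1 i ++ (γ p.2 i).drop (β p.1 i).length =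
        γ p.2 i ++ (β p.1 i).drop (γ p.2 i).length},
      x ∈ subcube fun i => α p.1.1 i ++ (γ p.1.2 i).drop (β p.1.1 i).length := by
  have key : ∀ p : {p : J × K // ∀ i, β p.1 i ++ (γ p.2 i).drop (β p.1 i).length =
        γ p.2 i ++ (β p.1 i).drop (γ p.2 i).length},
      (x ∈ subcube fun i => α p.1.1 i ++ (γ p.1.2 i).drop (β p.1.1 i).length) ↔
        x ∈ subcube (α p.1.1) ∧ h x ∈ subcube (γ p.1.2) := by
    rintro ⟨⟨j, k⟩, hp⟩
    constructor
    · intro hx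
      obtain ⟨y, rfl⟩ := mem_subcube_iff.1 hx
      rw [prependCube_append]
      refine ⟨prependCube_mem _ _, ?_⟩
      rw [hh, prependCube_mem_iff hp]
      exact prependCube_mem _ _
    · rintro ⟨h1, h2⟩
      obtain ⟨y, rfl⟩ := mem_subcube_iff.1 h1
      rw [hh, prependCube_mem_iff hp] at h2
      obtain ⟨z, rfl⟩ := mem_subcube_iff.1 h2
      rw [← prependCube_append]
      exact prependCube_mem _ _
  obtain ⟨j, hj, hj'⟩ := hα x
  obtain ⟨k, hk, hk'⟩ := hγ (h x)
  have hb : h x ∈ subcube (β j) := by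
    obtain ⟨y, rfl⟩ := mem_subcube_iff.1 hj
    rw [hh]
    exact prependCube_mem _ _
  refine ⟨⟨(j, k), fun i => append_drop_eq_of_prefix (h x i) (hb i) (hk i)⟩,
    (key _).2 ⟨hj, hk⟩, ?_⟩
  intro p hp
  have := (key p).1 hp
  exact Subtype.ext (Prod.ext (hj' _ this.1) (hk' _ this.2))

theorem IsRearrangement.mul {n : ℕ} {g h : CantorCube n ≃ₜ CantorCube n}
    (G : IsRearrangement g) (H : IsRearrangement h) : IsRearrangement (g * h) := by
  obtain ⟨J, hJ, α, β, hα, hβ, hh⟩ := H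
  obtain ⟨K, hK, γ, δ, hγ, hδ, hg⟩ := G
  have hg' (k : K) (x : CantorCube n) : g.symm (prependCube (δ k) x) = prependCube (γ k) x := by
    rw [← hg k x]
    exact g.symm_apply_apply _
  refine ⟨{p : J × K // ∀ i, β p.1 i ++ (γ p.2 i).drop (β p.1 i).length =
        γ p.2 i ++ (β p.1 i).drop (γ p.2 i).length}, inferInstance,
    fun p i => α p.1.1 i ++ (γ p.1.2 i).drop (β p.1.1 i).length,
    fun p i => δ p.1.2 i ++ (β p.1.1 i).drop (γ p.1.2 i).length,
    IsRearrangement.partition_comp hα hγ hh, ?_, ?_⟩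
  · intro x
    obtain ⟨⟨⟨k, j⟩, hp⟩, h1, h2⟩ := IsRearrangement.partition_comp hδ hβ hg' x
    refine ⟨⟨(j, k), fun i => (hp i).symm⟩, h1, ?_⟩
    rintro ⟨⟨j', k'⟩, hq⟩ hx
    have := h2 ⟨(k', j'), fun i => (hq i).symm⟩ hx
    simp only [Subtype.mk.injEq, Prod.mk.injEq] at this ⊢
    exact ⟨this.2, this.1⟩
  · rintro ⟨⟨j, k⟩, hp⟩ x
    change g (h _) = _
    rw [prependCube_append, hh, ← prependCube_append]
    simp only [hp]
    rw [prependCube_append, hg, ← prependCube_append]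

/-- The Brin-Thompson group `nV`: the group under composition of all rearrangements of the
Cantor cube `({0,1}^ω)^n`. -/
def BrinThompson (n : ℕ) : Subgroup (CantorCube n ≃ₜ CantorCube n) where
  carrier := {h | IsRearrangement h}
  one_mem' := IsRearrangement.one
  mul_mem' := IsRearrangement.mul
  inv_mem' := IsRearrangement.inv

/-! Suppose `A_Γ` acts on the cube by rearrangements and the translates of some subcube `D` are
pairwise disjoint. A subcube is a copy of the whole cube, so `nV` acts faithfully on `D`, trivially
outside. The conjugates of this copy by `A_Γ` have disjoint supports, so together with `A_Γ` they
generate the wreath product (`exists_wreathProduct_hom`).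

For the action, take one coordinate per element of `Option V × Option V`. The generator `v` uses a
sign coordinate `(v, none)` and the coordinates `(a, b)` where `a`, `b` are equal or non-adjacent
and one of them is `v`. Let `S v s` be the set of points with sign letter `s` and, at each such `(a,
b)`, first letter `true` exactly when `a = v`. The generator `v` acts by a rearrangement carrying
the complement of `S v false` onto `S v true` (`pushPop`).

Adjacent vertices use disjoint sets of coordinates, so their rearrangements commute and each
preserves the sets of the other. For distinct non-adjacent `v`, `w`, the sets of `v` and `w`
disagree at the coordinate `(v, w)`, hence are disjoint. Finally `D` has first letter `false` at
every `(v, v)`, where `S v s` demands `true`. Ping-pong (`pingPong`) then moves `D` off itself under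
every nontrivial element. -/

/-! ### The Brin-Thompson group as a group of permutations -/

theorem isOpen_subcube {n : ℕ} (u : Fin n → List Bool) : IsOpen (subcube u) := by
  have h : subcube u =
      ⋂ i : Fin n, ⋂ k : Fin (u i).length, {x : CantorCube n | x i k = (u i)[k]} := by
    ext x
    simp only [subcube, Set.mem_ofPred_eq, Set.mem_iInter]
    exact ⟨fun h i k => h i k k.2, fun h i k hk => h i ⟨k, hk⟩⟩
  rw [h]
  refine isOpen_iInter_of_finite fun i => isOpen_iInter_of_finite fun k => ?_
  have hc : Continuous fun x : CantorCube n => x i k := by fun_prop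
  exact (isOpen_discrete {(u i)[k]}).preimage hc

theorem continuous_prependCube {n : ℕ} (u : Fin n → List Bool) :
    Continuous (prependCube u) := by
  refine continuous_pi fun i => continuous_pi fun k => ?_
  by_cases h : k < (u i).length
  · simpa [prependCube, prependWord, h] using continuous_const
  · simp only [prependCube, prependWord, h, dite_false]
    fun_prop

/-- Removal of the first letters of each coordinate, as many as the words `u i` have. -/
def stripCube {n : ℕ} (u : Fin n → List Bool) (x : CantorCube n) : CantorCube n :=
  fun i k => x i (k + (u i).length)

theorem prependCube_stripCube {n : ℕ} {u : Fin n → List Bool} {x : CantorCube n}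
    (hx : x ∈ subcube u) : prependCube u (stripCube u x) = x := by
  funext i k
  by_cases h : k < (u i).length
  · simp [prependCube, prependWord, h, hx i k h]
  · simp [prependCube, prependWord, stripCube, h, Nat.sub_add_cancel (not_lt.mp h)]

theorem stripCube_prependCube {n : ℕ} (u : Fin n → List Bool) (x : CantorCube n) :
    stripCube u (prependCube u x) = x :=
  prependCube_injective u (prependCube_stripCube (prependCube_mem u x))

/-- The pieces are open, so continuity is local to one piece. Hence a bijection matching two finite
partitions is automatically a homeomorphism, and bare permutations suffice from here on. -/
theorem continuous_of_prependCube {n : ℕ} {J : Type*} {α β : J → Fin n → List Bool}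
    (hα : ∀ x : CantorCube n, ∃! j, x ∈ subcube (α j)) {h : CantorCube n → CantorCube n}
    (hh : ∀ (j : J) (x : CantorCube n), h (prependCube (α j) x) = prependCube (β j) x) :
    Continuous h := by
  refine continuous_iff_continuousAt.2 fun x => ?_
  obtain ⟨j, hj, -⟩ := hα x
  have hs : Continuous (stripCube (α j)) :=
    continuous_pi fun i => continuous_pi fun k => by unfold stripCube; fun_prop
  refine ((continuous_prependCube (β j)).comp hs).continuousAt.congr ?_
  filter_upwards [(isOpen_subcube (α j)).mem_nhds hj] with y hy
  rw [Function.comp_apply, ← hh, prependCube_stripCube hy]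

/-- The words `α j` describe a partition of the Cantor cube into subcubes. -/
def IsPartition {n : ℕ} {J : Type*} (α : J → Fin n → List Bool) : Prop :=
  ∀ x : CantorCube n, ∃! j, x ∈ subcube (α j)

/-- The permutation `h` maps the subcube of `α j` to that of `β j` by prefix replacement. -/
def ReplacesPrefixes {n : ℕ} {J : Type*} (α β : J → Fin n → List Bool)
    (h : Equiv.Perm (CantorCube n)) : Prop :=
  ∀ (j : J) (x : CantorCube n), h (prependCube (α j) x) = prependCube (β j) x

theorem ReplacesPrefixes.symm {n : ℕ} {J : Type*} {α β : J → Fin n → List Bool}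
    {h : Equiv.Perm (CantorCube n)} (hh : ReplacesPrefixes α β h) : ReplacesPrefixes β α h⁻¹ :=
  fun j x => by rw [Equiv.Perm.inv_eq_iff_eq, hh j x]

/-- A homeomorphism as a permutation of the points. -/
def homeomorphToPerm (X : Type*) [TopologicalSpace X] : (X ≃ₜ X) →* Equiv.Perm X where
  toFun h := h.toEquiv
  map_one' := rfl
  map_mul' _ _ := rfl

theorem homeomorphToPerm_injective (X : Type*) [TopologicalSpace X] :
    Function.Injective (homeomorphToPerm X) :=
  Homeomorph.toEquiv_injective

/-- The Brin-Thompson group as a group of permutations of the Cantor cube. -/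
def brinThompsonPerm (n : ℕ) : Subgroup (Equiv.Perm (CantorCube n)) :=
  (BrinThompson n).map (homeomorphToPerm _)

theorem mem_brinThompsonPerm_iff {n : ℕ} {h : Equiv.Perm (CantorCube n)} :
    h ∈ brinThompsonPerm n ↔ ∃ (J : Type) (_ : Finite J) (α β : J → Fin n → List Bool),
      IsPartition α ∧ IsPartition β ∧ ReplacesPrefixes α β h := by
  constructor
  · rintro ⟨g, hg, rfl⟩
    exact hg
  · rintro ⟨J, hJ, α, β, hα, hβ, hh⟩
    exact ⟨⟨h, continuous_of_prependCube hα hh, continuous_of_prependCube hβ hh.symm⟩,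
      ⟨J, hJ, α, β, hα, hβ, hh⟩, rfl⟩

/-- The permutation that replaces the prefixes `α` of one partition by those of another one. -/
theorem exists_replacesPrefixes {n : ℕ} {J : Type*} {α β : J → Fin n → List Bool}
    (hα : IsPartition α) (hβ : IsPartition β) :
    ∃ h : Equiv.Perm (CantorCube n), ReplacesPrefixes α β h := by
  have key {γ δ : J → Fin n → List Bool} (hγ : IsPartition γ) :
      ∃ f : CantorCube n → CantorCube n,
        ∀ j x, f (prependCube (γ j) x) = prependCube (δ j) x := by
    choose j hj hu using hγ
    refine ⟨fun x => prependCube (δ (j x)) (stripCube (γ (j x)) x), fun k x => ?_⟩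
    have hk : j (prependCube (γ k) x) = k := (hu _ k (prependCube_mem _ _)).symm
    simp only [hk, stripCube_prependCube]
  have inv {γ δ : J → Fin n → List Bool} {f g : CantorCube n → CantorCube n}
      (hγ : IsPartition γ) (hf : ∀ j x, f (prependCube (γ j) x) = prependCube (δ j) x)
      (hg : ∀ j x, g (prependCube (δ j) x) = prependCube (γ j) x) : Function.LeftInverse g f := by
    intro x
    obtain ⟨j, hj, -⟩ := hγ x
    obtain ⟨y, rfl⟩ := mem_subcube_iff.1 hj
    rw [hf, hg]
  obtain ⟨f, hf⟩ := key (δ := β) hα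
  obtain ⟨g, hg⟩ := key (δ := α) hβ
  exact ⟨⟨f, g, inv hα hf hg, inv hβ hg hf⟩, hf⟩

/-! ### Permutations that only see some of the coordinates -/

/-- The permutation `h` of the Cantor cube fixes the coordinates outside `Y`, and acts on those in
`Y` independently of the others. -/
structure ActsOnCoordinates {n : ℕ} (Y : Set (Fin n)) (h : Equiv.Perm (CantorCube n)) : Prop where
  apply_of_notMem : ∀ x, ∀ i ∉ Y, h x i = x i
  apply_congr : ∀ x y, (∀ i ∈ Y, x i = y i) → ∀ i ∈ Y, h x i = h y i

/-- This is the source of the defining relations of `A_Γ`. -/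
theorem ActsOnCoordinates.commute {n : ℕ} {Y Z : Set (Fin n)} {g h : Equiv.Perm (CantorCube n)}
    (hg : ActsOnCoordinates Y g) (hh : ActsOnCoordinates Z h) (hd : Disjoint Y Z) :
    g * h = h * g := by
  have key {Y Z : Set (Fin n)} {g h : Equiv.Perm (CantorCube n)} (hg : ActsOnCoordinates Y g)
      (hh : ActsOnCoordinates Z h) (hd : Disjoint Y Z) (x : CantorCube n) {i : Fin n}
      (hi : i ∈ Y) : g (h x) i = h (g x) i := by
    rw [hh.apply_of_notMem _ i (hd.notMem_of_mem_left hi)]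
    exact hg.apply_congr _ _
      (fun k hk => hh.apply_of_notMem _ k (hd.notMem_of_mem_left hk)) i hi
  refine Equiv.ext fun x => funext fun i => ?_
  change g (h x) i = h (g x) i
  by_cases hY : i ∈ Y
  · exact key hg hh hd x hY
  by_cases hZ : i ∈ Z
  · exact (key hh hg hd.symm x hZ).symm
  · rw [hg.apply_of_notMem _ i hY, hh.apply_of_notMem _ i hZ, hh.apply_of_notMem _ i hZ,
      hg.apply_of_notMem _ i hY]

/-- With empty words off `Y`, neither the choice of the piece nor the replaced prefix involves a
coordinate outside `Y`. -/
theorem ReplacesPrefixes.actsOnCoordinates {n : ℕ} {J : Type*} {α β : J → Fin n → List Bool}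
    {h : Equiv.Perm (CantorCube n)} (hα : IsPartition α) (hh : ReplacesPrefixes α β h)
    {Y : Set (Fin n)} (hαY : ∀ j, ∀ i ∉ Y, α j i = []) (hβY : ∀ j, ∀ i ∉ Y, β j i = []) :
    ActsOnCoordinates Y h := by
  have nil (z : ℕ → Bool) : prependWord [] z = z := by
    funext k
    simp [prependWord]
  constructor
  · intro x i hi
    obtain ⟨j, hj, -⟩ := hα x
    obtain ⟨z, rfl⟩ := mem_subcube_iff.1 hj
    rw [hh]
    simp [prependCube, hαY j i hi, hβY j i hi]
  · intro x y hxy i hi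
    obtain ⟨j, hj, -⟩ := hα x
    have hj' : y ∈ subcube (α j) := by
      intro k l hl
      by_cases hk : k ∈ Y
      · rw [← hxy k hk]
        exact hj k l hl
      · simp [hαY j k hk] at hl
    rw [← prependCube_stripCube hj, ← prependCube_stripCube hj', hh, hh]
    have : stripCube (α j) x i = stripCube (α j) y i := by
      funext k
      simp [stripCube, hxy i hi]
    simp only [prependCube, this]

/-! ### Pushing and popping letters -/

section PushPop

variable {n : ℕ} (N : Set (Fin n)) (c : Fin n → Bool) (i₀ : Fin n)

/-- The possible first letters at the coordinates in `N`, extended by `c`. -/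
abbrev Letters : Type := {ε : Fin n → Bool // ∀ i ∉ N, ε i = c i}

open Classical in
/-- The letters of `x` at the places `k` of the coordinates in `N`. -/
noncomputable def lettersAt (k : ℕ) (x : CantorCube n) : Letters N c :=
  ⟨fun i => if i ∈ N then x i k else c i, fun i hi => by simp [hi]⟩

/-- The letters `c`. -/
def Letters.base : Letters N c := ⟨c, fun _ _ => rfl⟩

theorem eq_lettersAt_iff {ε : Letters N c} {k : ℕ} {x : CantorCube n} :
    ε = lettersAt N c k x ↔ ∀ i ∈ N, x i k = ε.1 i := by
  constructor
  · rintro rfl i hi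
    simp [lettersAt, hi]
  · intro h
    refine Subtype.ext (funext fun i => ?_)
    by_cases hi : i ∈ N
    · simp [lettersAt, hi, h i hi]
    · simp [lettersAt, hi, ε.2 i hi]

open Classical in
/-- The words `ε i` at the coordinates in `N`, and the empty words elsewhere. -/
noncomputable def letterWords (ε : Letters N c) (i : Fin n) : List Bool :=
  if i ∈ N then [ε.1 i] else []

theorem mem_subcube_letterWords {ε : Letters N c} {x : CantorCube n} :
    x ∈ subcube (letterWords N c ε) ↔ ε = lettersAt N c 0 x := by
  rw [eq_lettersAt_iff]
  refine forall_congr' fun i => ?_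
  by_cases hi : i ∈ N <;> simp [letterWords, hi]

open Classical in
/-- The letters `ε` at the coordinates in `N`, and if they are `c`, also the letter `s` at `i₀`. -/
noncomputable def shortWords (s : Bool) (ε : Letters N c) (i : Fin n) : List Bool :=
  if i ∈ N then [ε.1 i] else if i = i₀ ∧ ε = Letters.base N c then [s] else []

open Classical in
/-- The letters `c` followed by `ε` at the coordinates in `N`, and the letter `s` at `i₀`. -/
noncomputable def longWords (s : Bool) (ε : Letters N c) (i : Fin n) : List Bool :=
  if i ∈ N then [c i, ε.1 i] else if i = i₀ then [s] else []

variable {i₀}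

theorem mem_subcube_shortWords (hi₀ : i₀ ∉ N) {s : Bool} {ε : Letters N c} {x : CantorCube n} :
    x ∈ subcube (shortWords N c i₀ s ε) ↔
      ε = lettersAt N c 0 x ∧ (ε = Letters.base N c → x i₀ 0 = s) := by
  rw [eq_lettersAt_iff]
  constructor
  · intro h
    refine ⟨fun i hi => ?_, fun hε => ?_⟩
    · have := h i 0 (by simp [shortWords, hi])
      simpa [shortWords, hi] using this
    · have := h i₀ 0 (by simp [shortWords, hi₀, hε])
      simpa [shortWords, hi₀, hε] using this
  · rintro ⟨h1, h2⟩ i k hk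
    by_cases hi : i ∈ N
    · simp only [shortWords, hi, if_true, List.length_singleton, Nat.lt_one_iff] at hk
      subst hk
      simp [shortWords, hi, h1 i hi]
    · by_cases hi' : i = i₀ ∧ ε = Letters.base N c
      · simp only [shortWords, if_neg hi, if_pos hi', List.length_singleton,
          Nat.lt_one_iff] at hk
        subst hk
        simp [shortWords, hi', hi₀, h2 hi'.2]
      · simp [shortWords, hi, hi'] at hk

theorem mem_subcube_longWords (hi₀ : i₀ ∉ N) {s : Bool} {ε : Letters N c} {x : CantorCube n} :
    x ∈ subcube (longWords N c i₀ s ε) ↔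
      Letters.base N c = lettersAt N c 0 x ∧ ε = lettersAt N c 1 x ∧ x i₀ 0 = s := by
  rw [eq_lettersAt_iff, eq_lettersAt_iff]
  constructor
  · intro h
    refine ⟨fun i hi => ?_, fun i hi => ?_, ?_⟩
    · have := h i 0 (by simp [longWords, hi])
      simpa [longWords, hi, Letters.base] using this
    · have := h i 1 (by simp [longWords, hi])
      simpa [longWords, hi] using this
    · have := h i₀ 0 (by simp [longWords, hi₀])
      simpa [longWords, hi₀] using this
  · rintro ⟨h0, h1, h2⟩ i k hk
    by_cases hi : i ∈ N
    · simp only [longWords, hi, if_true, List.length_cons, List.length_nil] at hk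
      obtain rfl | rfl : k = 0 ∨ k = 1 := by omega
      · simpa [longWords, hi, Letters.base] using h0 i hi
      · simpa [longWords, hi] using h1 i hi
    · by_cases hi' : i = i₀
      · simp only [longWords, if_neg hi, if_pos hi', List.length_singleton,
          Nat.lt_one_iff] at hk
        subst hk
        simp [longWords, hi', hi₀, h2]
      · simp [longWords, hi, hi'] at hk

variable (i₀)

/-- The domain partition of `pushPop`. -/
noncomputable def pushPopWords (s : Bool) : Letters N c × Bool → Fin n → List Bool
  | (ε, true) => shortWords N c i₀ s ε
  | (ε, false) => longWords N c i₀ (!s) ε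

variable {i₀}

/-- The long words partition the points with letters `c` on `N` and `!s` at `i₀`; the short words
partition the complement of that set. -/
theorem isPartition_pushPopWords (hi₀ : i₀ ∉ N) (s : Bool) :
    IsPartition (pushPopWords N c i₀ s) := by
  intro x
  have hS (ε : Letters N c) : x ∈ subcube (pushPopWords N c i₀ s (ε, true)) ↔ _ :=
    mem_subcube_shortWords N c hi₀
  have hL (ε : Letters N c) : x ∈ subcube (pushPopWords N c i₀ s (ε, false)) ↔ _ :=
    mem_subcube_longWords N c hi₀
  by_cases hP : lettersAt N c 0 x = Letters.base N c
  · by_cases hs : x i₀ 0 = s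
    · refine ⟨(Letters.base N c, true), (hS _).2 ⟨hP.symm, fun _ => hs⟩, ?_⟩
      rintro ⟨ε, _ | _⟩ hε
      · have := ((hL ε).1 hε).2.2
        simp [hs] at this
      · rw [((hS ε).1 hε).1, hP]
    · refine ⟨(lettersAt N c 1 x, false), (hL _).2 ⟨hP.symm, rfl, Bool.eq_not.2 hs⟩, ?_⟩
      rintro ⟨ε, _ | _⟩ hε
      · rw [((hL ε).1 hε).2.1]
      · have := (hS ε).1 hε
        exact absurd (this.2 (this.1.trans hP)) hs
  · refine ⟨(lettersAt N c 0 x, true), (hS _).2 ⟨rfl, fun h => absurd h hP⟩, ?_⟩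
    rintro ⟨ε, _ | _⟩ hε
    · exact absurd ((hL ε).1 hε).1.symm hP
    · rw [((hS ε).1 hε).1]

/-- The range partition of `pushPop`. -/
noncomputable def pushPopWords' (i₀ : Fin n) (s : Bool) (p : Letters N c × Bool) :
    Fin n → List Bool :=
  pushPopWords N c i₀ (!s) (p.1, !p.2)

theorem isPartition_pushPopWords' (hi₀ : i₀ ∉ N) (s : Bool) :
    IsPartition (pushPopWords' N c i₀ s) := by
  intro x
  obtain ⟨⟨ε, b⟩, h1, h2⟩ := isPartition_pushPopWords N c hi₀ (!s) x
  refine ⟨(ε, !b), by simpa [pushPopWords'] using h1, ?_⟩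
  rintro ⟨ε', b'⟩ h
  have := h2 (ε', !b') h
  simp only [Prod.mk.injEq] at this ⊢
  refine ⟨this.1, ?_⟩
  rw [← this.2, Bool.not_not]

theorem exists_pushPop (hi₀ : i₀ ∉ N) : ∃ h : Equiv.Perm (CantorCube n),
    ReplacesPrefixes (pushPopWords N c i₀ true) (pushPopWords' N c i₀ true) h :=
  exists_replacesPrefixes (isPartition_pushPopWords N c hi₀ true)
    (isPartition_pushPopWords' N c hi₀ true)

/-- The rearrangement that maps the complement of `{x | x begins with c on N and with false at i₀}`
onto `{x | x begins with c on N and with true at i₀}`. -/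
noncomputable def pushPop (hi₀ : i₀ ∉ N) : Equiv.Perm (CantorCube n) :=
  (exists_pushPop N c hi₀).choose

/-- `pushPop` or its inverse. -/
noncomputable def signedPushPop (hi₀ : i₀ ∉ N) (s : Bool) : Equiv.Perm (CantorCube n) :=
  cond s (pushPop N c hi₀) (pushPop N c hi₀)⁻¹

theorem replacesPrefixes_signedPushPop (hi₀ : i₀ ∉ N) (s : Bool) :
    ReplacesPrefixes (pushPopWords N c i₀ s) (pushPopWords' N c i₀ s)
      (signedPushPop N c hi₀ s) := by
  have h := (exists_pushPop N c hi₀).choose_spec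
  -- Changing the sign interchanges the domain and range partitions, up to flipping the Boolean
  -- index, so the inverse obeys the same formula.
  cases s
  · rintro ⟨ε, b⟩ x
    have := h.symm (ε, !b) x
    simp only [pushPopWords', Bool.not_not, Bool.not_true] at this
    exact this
  · exact h

theorem pushPop_mem (hi₀ : i₀ ∉ N) : pushPop N c hi₀ ∈ brinThompsonPerm n :=
  mem_brinThompsonPerm_iff.2 ⟨Letters N c × Bool, inferInstance, _, _,
    isPartition_pushPopWords N c hi₀ true, isPartition_pushPopWords' N c hi₀ true,
    replacesPrefixes_signedPushPop N c hi₀ true⟩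

theorem actsOnCoordinates_signedPushPop (hi₀ : i₀ ∉ N) (s : Bool) :
    ActsOnCoordinates (insert i₀ N) (signedPushPop N c hi₀ s) := by
  have key (s : Bool) (j : Letters N c × Bool) (i : Fin n) (hi : i ∉ insert i₀ N) :
      pushPopWords N c i₀ s j i = [] := by
    simp only [Set.mem_insert_iff, not_or] at hi
    obtain ⟨ε, _ | _⟩ := j <;> simp [pushPopWords, shortWords, longWords, hi]
  exact (replacesPrefixes_signedPushPop N c hi₀ s).actsOnCoordinates
    (isPartition_pushPopWords N c hi₀ s) (key s) fun j => key (!s) _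

/-- The attracting set of `signedPushPop`. -/
def sink (i₀ : Fin n) (s : Bool) : Set (CantorCube n) :=
  {x | (∀ i ∈ N, x i 0 = c i) ∧ x i₀ 0 = s}

/-- Outside the opposite sink a point lies in a short piece, and short pieces go to long pieces,
which make up the sink. This is the only dynamical fact that ping-pong needs. -/
theorem signedPushPop_mem_sink (hi₀ : i₀ ∉ N) {s : Bool} {x : CantorCube n}
    (hx : x ∉ sink N c i₀ (!s)) : signedPushPop N c hi₀ s x ∈ sink N c i₀ s := by
  obtain ⟨⟨ε, b⟩, hj, -⟩ := isPartition_pushPopWords N c hi₀ s x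
  cases b
  · refine absurd ?_ hx
    have := (mem_subcube_longWords N c hi₀).1 hj
    exact ⟨(eq_lettersAt_iff N c).1 this.1, this.2.2⟩
  · obtain ⟨z, rfl⟩ := mem_subcube_iff.1 hj
    rw [replacesPrefixes_signedPushPop]
    have h : prependCube (pushPopWords' N c i₀ s (ε, true)) z ∈
        subcube (longWords N c i₀ (!!s) ε) := prependCube_mem _ _
    have := (mem_subcube_longWords N c hi₀).1 h
    rw [Bool.not_not] at this
    exact ⟨(eq_lettersAt_iff N c).1 this.1, this.2.2⟩

end PushPop

/-! ### The copy of the Brin-Thompson group supported on a subcube -/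

/-- The Cantor cube is a copy of each of its subcubes. -/
noncomputable def cubeEquivSubcube {n : ℕ} (u : Fin n → List Bool) :
    CantorCube n ≃ {x // x ∈ subcube u} where
  toFun x := ⟨prependCube u x, prependCube_mem u x⟩
  invFun x := stripCube u x.1
  left_inv x := stripCube_prependCube u x
  right_inv x := Subtype.ext (prependCube_stripCube x.2)

open Classical in
/-- The action of the Brin-Thompson group on a subcube. -/
noncomputable def localAction {n : ℕ} (u : Fin n → List Bool) :
    BrinThompson n →* Equiv.Perm (CantorCube n) :=
  ((Equiv.Perm.extendDomainHom (cubeEquivSubcube u)).comp (homeomorphToPerm _)).comp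
    (BrinThompson n).subtype

theorem localAction_injective {n : ℕ} (u : Fin n → List Bool) :
    Function.Injective (localAction u) := by
  classical
  exact ((Equiv.Perm.extendDomainHom_injective _).comp (homeomorphToPerm_injective _)).comp
    Subtype.val_injective

theorem localAction_prependCube {n : ℕ} (u : Fin n → List Bool) (h : BrinThompson n)
    (x : CantorCube n) : localAction u h (prependCube u x) = prependCube u (h.1 x) := by
  classical
  exact Equiv.Perm.extendDomain_apply_image (homeomorphToPerm _ h.1) (cubeEquivSubcube u) x

theorem localAction_of_notMem {n : ℕ} (u : Fin n → List Bool) (h : BrinThompson n)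
    {x : CantorCube n} (hx : x ∉ subcube u) : localAction u h x = x := by
  classical
  exact Equiv.Perm.extendDomain_apply_not_subtype _ _ hx

/-- A partition of the cube is copied into the subcube with letters `c` on `N`; the other choices of
letters on `N` cut up the complement, on which the local action is trivial. -/
theorem isPartition_sum_letterWords {n : ℕ} (N : Set (Fin n)) (c : Fin n → Bool) {J : Type*}
    {α : J → Fin n → List Bool} (hα : IsPartition α) :
    IsPartition (Sum.elim (fun j i => letterWords N c (Letters.base N c) i ++ α j i)
      fun ε : {ε : Letters N c // ε ≠ Letters.base N c} => letterWords N c ε.1) := by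
  intro x
  by_cases hx : x ∈ subcube (letterWords N c (Letters.base N c))
  · obtain ⟨y, rfl⟩ := mem_subcube_iff.1 hx
    obtain ⟨j, hj, hu⟩ := hα y
    have hL (j : J) : (prependCube (letterWords N c (Letters.base N c)) y ∈
        subcube fun i => letterWords N c (Letters.base N c) i ++ α j i) ↔ y ∈ subcube (α j) := by
      constructor
      · intro h
        obtain ⟨z, hz⟩ := mem_subcube_iff.1 h
        rw [prependCube_append] at hz
        rw [← prependCube_injective _ hz]
        exact prependCube_mem _ _
      · intro h
        obtain ⟨z, rfl⟩ := mem_subcube_iff.1 h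
        rw [← prependCube_append]
        exact prependCube_mem _ _
    refine ⟨Sum.inl j, (hL j).2 hj, ?_⟩
    rintro (k | ε) hk
    · rw [hu k ((hL k).1 hk)]
    · refine absurd ?_ ε.2
      exact ((mem_subcube_letterWords N c).1 hk).trans ((mem_subcube_letterWords N c).1 hx).symm
  · rw [mem_subcube_letterWords] at hx
    refine ⟨Sum.inr ⟨lettersAt N c 0 x, Ne.symm hx⟩, (mem_subcube_letterWords N c).2 rfl, ?_⟩
    rintro (k | ε) hk
    · refine absurd ((mem_subcube_letterWords N c).1 ?_) hx
      obtain ⟨z, rfl⟩ := mem_subcube_iff.1 hk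
      simp only [Sum.elim_inl]
      rw [prependCube_append]
      exact prependCube_mem _ _
    · exact congrArg Sum.inr (Subtype.ext ((mem_subcube_letterWords N c).1 hk))

theorem localAction_letterWords_mem {n : ℕ} (N : Set (Fin n)) (c : Fin n → Bool)
    (h : BrinThompson n) :
    localAction (letterWords N c (Letters.base N c)) h ∈ brinThompsonPerm n := by
  obtain ⟨J, hJ, α, β, hα, hβ, hh⟩ := h.2
  refine mem_brinThompsonPerm_iff.2 ⟨_, inferInstance, _, _, isPartition_sum_letterWords N c hα,
    isPartition_sum_letterWords N c hβ, ?_⟩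
  rintro (j | ε) x
  · simp only [Sum.elim_inl]
    rw [prependCube_append, localAction_prependCube, hh, prependCube_append]
  · refine localAction_of_notMem _ _ fun hx => ε.2 ?_
    rw [(mem_subcube_letterWords N c).1 (prependCube_mem (letterWords N c ε.1) x)]
    exact ((mem_subcube_letterWords N c).1 hx).symm

/-! ### Wreath products acting on a set -/

/-- `translatesAction` is defined for all functions, but only the finitely supported ones, being
finite products of `Pi.mulSingle`, need give elements of `R`. -/
theorem mem_of_finite_mulSupport {G H A : Type*} [Group H] [Group A] (θ : (G → H) →* A)
    (R : Subgroup A) [DecidableEq G] (hR : ∀ g h, θ (Pi.mulSingle g h) ∈ R) {f : G → H}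
    (hf : (Function.mulSupport f).Finite) : θ f ∈ R := by
  obtain ⟨s, hs⟩ : ∃ s : Finset G, Function.mulSupport f ⊆ s := ⟨hf.toFinset, by simp⟩
  clear hf
  induction s using Finset.induction_on generalizing f with
  | empty =>
    have : f = 1 := by
      simpa using hs
    rw [this, map_one]
    exact one_mem R
  | insert a s ha ih =>
    have h1 : f = Pi.mulSingle a (f a) * Function.update f a 1 := by
      funext x
      by_cases hx : x = a
      · subst hx
        simp
      · simp [hx]
    rw [h1, map_mul]
    refine mul_mem (hR _ _) (ih fun x hx => ?_)
    have hxa : x ≠ a := by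
      rintro rfl
      simp at hx
    have hx' : x ∈ Function.mulSupport f := by
      simpa [hxa] using hx
    simpa [hxa] using hs hx'

section Wreath

variable {X H G : Type*} [Group H] [Group G] (ρ : G →* Equiv.Perm X) (δ : H →* Equiv.Perm X)
  (D : Set X)

open Classical in
/-- The function `f` acts on the translate `ρ g D` of `D` by the conjugate of `δ (f g)`. -/
noncomputable def translatesMap (f : G → H) (x : X) : X :=
  if h : ∃ g, (ρ g)⁻¹ x ∈ D then ρ h.choose (δ (f h.choose) ((ρ h.choose)⁻¹ x)) else x

variable {ρ δ D}

theorem eq_of_mem_translates (hD : ∀ g, g ≠ 1 → ∀ x ∈ D, ρ g x ∉ D) {g h : G} {x : X}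
    (hg : (ρ g)⁻¹ x ∈ D) (hh : (ρ h)⁻¹ x ∈ D) : g = h := by
  by_contra hne
  refine hD (h⁻¹ * g) (fun h1 => hne (inv_mul_eq_one.1 h1).symm) _ hg ?_
  simpa using hh

theorem translatesMap_of_mem (hD : ∀ g, g ≠ 1 → ∀ x ∈ D, ρ g x ∉ D) (f : G → H) {g : G} {x : X}
    (hx : (ρ g)⁻¹ x ∈ D) : translatesMap ρ δ D f x = ρ g (δ (f g) ((ρ g)⁻¹ x)) := by
  have h : ∃ g, (ρ g)⁻¹ x ∈ D := ⟨g, hx⟩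
  have hg : h.choose = g := eq_of_mem_translates hD h.choose_spec hx
  rw [translatesMap, dif_pos h, hg]

theorem translatesMap_of_notMem (f : G → H) {x : X} (hx : ∀ g, (ρ g)⁻¹ x ∉ D) :
    translatesMap ρ δ D f x = x := by
  rw [translatesMap, dif_neg (not_exists.2 hx)]

theorem apply_mem_of_fixes {δ : H →* Equiv.Perm X} (hδ : ∀ h, ∀ x ∉ D, δ h x = x) (h : H) {x : X}
    (hx : x ∈ D) : δ h x ∈ D := by
  by_contra hn
  have := hδ h⁻¹ _ hn
  rw [map_inv, Equiv.Perm.inv_eq_iff_eq] at this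
  exact hn ((δ h).injective this ▸ hx)

/-- The action of all functions `G → H` on the translates of `D`. -/
noncomputable def translatesAction (hD : ∀ g, g ≠ 1 → ∀ x ∈ D, ρ g x ∉ D)
    (hδ : ∀ h, ∀ x ∉ D, δ h x = x) : (G → H) →* Equiv.Perm X :=
  MonoidHom.toHomPerm
    { toFun := fun f => (translatesMap ρ δ D f : Function.End X)
      map_one' := by
        funext x
        by_cases hx : ∃ g, (ρ g)⁻¹ x ∈ D
        · obtain ⟨g, hg⟩ := hx
          rw [translatesMap_of_mem hD _ hg, Pi.one_apply, map_one, Equiv.Perm.one_apply]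
          exact (ρ g).apply_symm_apply x
        · rw [translatesMap_of_notMem _ (not_exists.1 hx)]
          rfl
      map_mul' := fun f f' => by
        funext x
        change _ = translatesMap ρ δ D f (translatesMap ρ δ D f' x)
        by_cases hx : ∃ g, (ρ g)⁻¹ x ∈ D
        · obtain ⟨g, hg⟩ := hx
          rw [translatesMap_of_mem hD f' hg, translatesMap_of_mem hD _ hg,
            translatesMap_of_mem (g := g) hD f]
          · simp
          · simpa using apply_mem_of_fixes hδ (f' g) hg
        · rw [translatesMap_of_notMem _ (not_exists.1 hx),
            translatesMap_of_notMem _ (not_exists.1 hx),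
            translatesMap_of_notMem _ (not_exists.1 hx)] }

theorem translatesAction_apply (hD : ∀ g, g ≠ 1 → ∀ x ∈ D, ρ g x ∉ D)
    (hδ : ∀ h, ∀ x ∉ D, δ h x = x) (f : G → H) (x : X) :
    translatesAction hD hδ f x = translatesMap ρ δ D f x := rfl

theorem translatesAction_mulSingle [DecidableEq G] (hD : ∀ g, g ≠ 1 → ∀ x ∈ D, ρ g x ∉ D)
    (hδ : ∀ h, ∀ x ∉ D, δ h x = x) (g : G) (h : H) :
    translatesAction hD hδ (Pi.mulSingle g h) = ρ g * δ h * (ρ g)⁻¹ := by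
  ext x
  rw [translatesAction_apply]
  by_cases hx : (ρ g)⁻¹ x ∈ D
  · rw [translatesMap_of_mem hD _ hx]
    simp
  · have h1 : (ρ g * δ h * (ρ g)⁻¹) x = x := by
      change ρ g (δ h ((ρ g)⁻¹ x)) = x
      rw [hδ h _ hx]
      exact (ρ g).apply_symm_apply x
    rw [h1]
    by_cases hx' : ∃ g', (ρ g')⁻¹ x ∈ D
    · obtain ⟨g', hg'⟩ := hx'
      have hne : g' ≠ g := by
        rintro rfl
        exact hx hg'
      rw [translatesMap_of_mem hD _ hg', Pi.mulSingle_eq_of_ne hne]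
      simp
    · exact translatesMap_of_notMem _ (not_exists.1 hx')

theorem translatesAction_translate (hD : ∀ g, g ≠ 1 → ∀ x ∈ D, ρ g x ∉ D)
    (hδ : ∀ h, ∀ x ∉ D, δ h x = x) (g : G) (f : directPower G H) :
    translatesAction hD hδ (directPower.translate g f).1 =
      ρ g * translatesAction hD hδ f.1 * (ρ g)⁻¹ := by
  ext x
  change translatesMap ρ δ D _ x = ρ g (translatesMap ρ δ D f.1 ((ρ g)⁻¹ x))
  by_cases hx : ∃ k, (ρ k)⁻¹ x ∈ D
  · obtain ⟨k, hk⟩ := hx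
    rw [translatesMap_of_mem hD _ hk, translatesMap_of_mem (g := g⁻¹ * k) hD f.1]
    · simp [directPower.translate]
    · simpa using hk
  · rw [translatesMap_of_notMem _ (not_exists.1 hx), translatesMap_of_notMem]
    · simp
    · intro k hk
      refine hx ⟨g * k, ?_⟩
      simpa using hk

/-- If the translates of a nonempty set `D` by a group `G` of permutations are pairwise disjoint,
and `H` acts faithfully on `D`, then the wreath product of `H` by `G` acts faithfully. -/
theorem exists_wreathProduct_hom (R : Subgroup (Equiv.Perm X))
    (hD : ∀ g, g ≠ 1 → ∀ x ∈ D, ρ g x ∉ D) (hδ : ∀ h, ∀ x ∉ D, δ h x = x) (hne : D.Nonempty)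
    (hinj : Function.Injective δ) (hρR : ∀ g, ρ g ∈ R) (hδR : ∀ h, δ h ∈ R) :
    ∃ φ : RestrictedWreathProduct H G →* R, Function.Injective φ := by
  classical
  have hcomp (g : G) :
      ((translatesAction hD hδ).comp (directPower G H).subtype).comp
          (directPower.shift G H g).toMonoidHom =
        (MulAut.conj (ρ g)).toMonoidHom.comp
          ((translatesAction hD hδ).comp (directPower G H).subtype) :=
    MonoidHom.ext fun f => translatesAction_translate hD hδ g f
  let φ : RestrictedWreathProduct H G →* Equiv.Perm X :=
    SemidirectProduct.lift ((translatesAction hD hδ).comp (directPower G H).subtype) ρ hcomp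
  have hφ (p : RestrictedWreathProduct H G) (x : X) :
      φ p x = translatesMap ρ δ D p.left.1 (ρ p.right x) := rfl
  have hφR (p : RestrictedWreathProduct H G) : φ p ∈ R := by
    refine mul_mem (mem_of_finite_mulSupport (translatesAction hD hδ) R (fun g h => ?_)
      p.left.2) (hρR p.right)
    rw [translatesAction_mulSingle]
    exact mul_mem (mul_mem (hρR g) (hδR h)) (inv_mem (hρR g))
  refine ⟨φ.codRestrict R hφR, (injective_iff_map_eq_one _).2 fun p hp => ?_⟩
  have hp (x : X) : translatesMap ρ δ D p.left.1 (ρ p.right x) = x := by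
    rw [← hφ]
    exact congrArg (fun q : R => q.1 x) hp
  -- Otherwise a point of `D` is sent into the translate of `D` by `p.right`, which misses `D`.
  have hright : p.right = 1 := by
    obtain ⟨x, hx⟩ := hne
    by_contra h1
    have hi : (ρ p.right)⁻¹ (ρ p.right x) = x := (ρ p.right).symm_apply_apply x
    have := hp x
    rw [translatesMap_of_mem hD _ (hi.symm ▸ hx), hi] at this
    exact hD _ h1 _ (apply_mem_of_fixes hδ (p.left.1 p.right) hx) (this.symm ▸ hx)
  -- Now only the base group acts, and its value at `g` can be read off on the translate `ρ g D`.
  refine SemidirectProduct.ext (Subtype.ext (funext fun g => hinj (Equiv.ext fun x => ?_))) hright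
  change δ (p.left.1 g) x = δ 1 x
  rw [map_one, Equiv.Perm.one_apply]
  by_cases hx : x ∈ D
  · have := hp (ρ g x)
    rw [hright, map_one, Equiv.Perm.one_apply, translatesMap_of_mem (g := g) hD] at this
    · simpa using this
    · simpa using hx
  · exact hδ _ x hx

end Wreath

/-! ### Ping-pong for right-angled Artin groups -/

namespace RightAngledArtinGroup

variable {V : Type*} {Γ : SimpleGraph V}

/-- The generator `v` or its inverse. -/
def letter (Γ : SimpleGraph V) (l : V × Bool) : RightAngledArtinGroup Γ :=
  cond l.2 (PresentedGroup.of l.1) (PresentedGroup.of l.1)⁻¹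

theorem letter_mul_letter_not (v : V) (s : Bool) : letter Γ (v, s) * letter Γ (v, !s) = 1 := by
  cases s <;> simp [letter]

theorem letter_commute {v w : V} (h : Γ.Adj v w) (s t : Bool) :
    Commute (letter Γ (v, s)) (letter Γ (w, t)) := by
  have h1 : Commute (PresentedGroup.of v : RightAngledArtinGroup Γ) (PresentedGroup.of w) := by
    have := PresentedGroup.one_of_mem (rels := {r : FreeGroup V | ∃ v w : V, Γ.Adj v w ∧
      r = FreeGroup.of v * FreeGroup.of w * (FreeGroup.of v)⁻¹ * (FreeGroup.of w)⁻¹})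
      ⟨v, w, h, rfl⟩
    simp only [map_mul, map_inv] at this
    exact mul_inv_eq_iff_eq_mul.1 (mul_inv_eq_one.1 this)
  cases s <;> cases t <;> simpa [letter] using h1

/-! ### Words and word length. -/

theorem exists_prod_letters (g : RightAngledArtinGroup Γ) :
    ∃ l : List (V × Bool), (l.map (letter Γ)).prod = g := by
  obtain ⟨x, rfl⟩ := PresentedGroup.mk_surjective _ g
  obtain ⟨w, rfl⟩ := Quot.exists_rep x
  refine ⟨w, ?_⟩
  rw [FreeGroup.quot_mk_eq_mk]
  induction w with
  | nil => exact (map_one _).symm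
  | cons p l ih =>
    rw [List.map_cons, List.prod_cons, ih]
    have : FreeGroup.mk (p :: l) = FreeGroup.mk [p] * FreeGroup.mk l := by simp
    rw [this, map_mul]
    congr 1
    obtain ⟨v, _ | _⟩ := p
    · exact (map_inv (PresentedGroup.mk _) (FreeGroup.of v)).symm
    · rfl

/-- The word length. -/
noncomputable def length (g : RightAngledArtinGroup Γ) : ℕ :=
  sInf {k | ∃ l : List (V × Bool), (l.map (letter Γ)).prod = g ∧ l.length = k}

theorem exists_length_eq (g : RightAngledArtinGroup Γ) :
    ∃ l : List (V × Bool), (l.map (letter Γ)).prod = g ∧ l.length = length g :=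
  Nat.sInf_mem (s := {k | ∃ l : List (V × Bool), (l.map (letter Γ)).prod = g ∧ l.length = k})
    ((exists_prod_letters g).imp' List.length fun l hl => ⟨l, hl, rfl⟩)

theorem length_prod_le (l : List (V × Bool)) : length (l.map (letter Γ)).prod ≤ l.length :=
  Nat.sInf_le ⟨l, rfl, rfl⟩

theorem length_letter_mul_le (l : V × Bool) (g : RightAngledArtinGroup Γ) :
    length (letter Γ l * g) ≤ length g + 1 := by
  obtain ⟨w, rfl, hw⟩ := exists_length_eq g
  rw [← hw]
  exact length_prod_le (l :: w)

theorem exists_eq_letter_mul {g : RightAngledArtinGroup Γ} (hg : g ≠ 1) :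
    ∃ l g', g = letter Γ l * g' ∧ length g = length g' + 1 := by
  obtain ⟨w, rfl, hw⟩ := exists_length_eq g
  cases w with
  | nil => exact absurd rfl hg
  | cons l w =>
    refine ⟨l, (w.map (letter Γ)).prod, by simp, le_antisymm ?_ ?_⟩
    · exact length_letter_mul_le l _
    · rw [← hw]
      exact Nat.succ_le_succ (length_prod_le w)

/-- The ping-pong lemma for right-angled Artin groups. -/
theorem pingPong {X : Type*} (ρ : RightAngledArtinGroup Γ →* Equiv.Perm X)
    (S : V → Bool → Set X) (D : Set X)
    (hbase : ∀ v s, ∀ x ∈ D, ρ (letter Γ (v, s)) x ∈ S v s)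
    (hself : ∀ v s, ∀ x ∈ S v s, ρ (letter Γ (v, s)) x ∈ S v s)
    (hadj : ∀ v w, Γ.Adj v w → ∀ s t, ∀ x ∈ S w t, ρ (letter Γ (v, s)) x ∈ S w t)
    (hnon : ∀ v w, v ≠ w → ¬ Γ.Adj v w → ∀ s t, ∀ x ∈ S w t, ρ (letter Γ (v, s)) x ∈ S v s)
    (hdisj : ∀ v s, ∀ x ∈ D, x ∉ S v s) (g : RightAngledArtinGroup Γ) (hg : g ≠ 1) :
    ∀ x ∈ D, ρ g x ∉ D := by
  -- Every letter that can begin a shortest word for an element names a set into which that element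
  -- sends `D`. An element may have several such letters, so the induction hypothesis covers them
  -- all.
  have key (k : ℕ) : ∀ (v : V) (s : Bool) (g : RightAngledArtinGroup Γ), length g = k →
      length (letter Γ (v, s) * g) = k + 1 → ∀ x ∈ D, ρ (letter Γ (v, s) * g) x ∈ S v s := by
    induction k with
    | zero =>
      intro v s g hg _ x hx
      have h1 : g = 1 := by
        by_contra h1
        obtain ⟨l, g', -, h⟩ := exists_eq_letter_mul h1
        omega
      rw [h1, mul_one]
      exact hbase v s x hx
    | succ k ih =>
      intro v s g hg hvg x hx
      have h1 : g ≠ 1 := by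
        rintro rfl
        have := length_prod_le (Γ := Γ) []
        simp only [List.map_nil, List.prod_nil, List.length_nil] at this
        omega
      obtain ⟨⟨w, t⟩, g', rfl, hl⟩ := exists_eq_letter_mul h1
      by_cases hvw : v = w
      · subst hvw
        -- Opposite signs would cancel and shorten the product.
        have hst : s = t := by
          by_contra hst
          obtain rfl : t = !s := by cases s <;> cases t <;> simp_all
          rw [← mul_assoc, letter_mul_letter_not, one_mul] at hvg
          omega
        subst hst
        rw [map_mul]
        exact hself v s _ (ih v s g' (by omega) (by omega) x hx)
      by_cases ha : Γ.Adj v w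
      · have hc : letter Γ (v, s) * (letter Γ (w, t) * g') =
            letter Γ (w, t) * (letter Γ (v, s) * g') := by
          rw [← mul_assoc, (letter_commute ha s t).eq, mul_assoc]
        rw [hc] at hvg ⊢
        -- After the swap, these bounds force `(v, s)` to lengthen `g'`, so the induction hypothesis
        -- applies with `v` and the letter of `w` preserves `S v s`.
        have h2 := length_letter_mul_le (v, s) g'
        have h3 := length_letter_mul_le (w, t) (letter Γ (v, s) * g')
        rw [map_mul]
        exact hadj w v ha.symm t s _ (ih v s g' (by omega) (by omega) x hx)
      · rw [map_mul]
        exact hnon v w hvw ha s t _ (ih w t g' (by omega) (by omega) x hx)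
  intro x hx hD
  obtain ⟨⟨v, s⟩, g', rfl, hl⟩ := exists_eq_letter_mul hg
  exact hdisj v s _ hD (key _ v s g' rfl hl x hx)

end RightAngledArtinGroup

/-! ### The action of a right-angled Artin group on a Cantor cube -/

section Action

variable {V : Type*} (Γ : SimpleGraph V) {n : ℕ} (e : Option V × Option V ≃ Fin n)

/-- The coordinates of the pairs of `v` with the vertices that are not adjacent to `v`. -/
def pairCoordinates (v : V) : Set (Fin n) :=
  {i | ∃ a b, ¬ Γ.Adj a b ∧ (a = v ∨ b = v) ∧ i = e (some a, some b)}

open Classical in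
/-- The letters that distinguish `v` from the vertices that are not adjacent to `v`. -/
noncomputable def pairLetters (v : V) (i : Fin n) : Bool :=
  decide ((e.symm i).1 = some v)

/-- The coordinate of the sign of `v`. -/
def signCoordinate (v : V) : Fin n := e (some v, none)

theorem signCoordinate_notMem (v w : V) : signCoordinate e v ∉ pairCoordinates Γ e w := by
  rintro ⟨a, b, -, -, h⟩
  simp [signCoordinate] at h

/-- For distinct `v`, `w`, a shared pair coordinate could only be `(v, w)` or `(w, v)`, and adjacent
pairs are left out. -/
theorem disjoint_coordinates {v w : V} (h : Γ.Adj v w) :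
    Disjoint (insert (signCoordinate e v) (pairCoordinates Γ e v))
      (insert (signCoordinate e w) (pairCoordinates Γ e w)) := by
  rw [Set.disjoint_left]
  rintro i (rfl | hv) (hw | hw)
  · simp only [signCoordinate, EmbeddingLike.apply_eq_iff_eq, Prod.mk.injEq, Option.some.injEq,
      and_true] at hw
    exact h.ne hw
  · exact signCoordinate_notMem Γ e v w hw
  · exact signCoordinate_notMem Γ e w v (hw ▸ hv)
  · obtain ⟨a, b, hab, hv, rfl⟩ := hv
    obtain ⟨a', b', -, hw, heq⟩ := hw
    simp only [EmbeddingLike.apply_eq_iff_eq, Prod.mk.injEq, Option.some.injEq] at heq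
    obtain ⟨rfl, rfl⟩ := heq
    rcases hv with rfl | rfl <;> rcases hw with rfl | rfl
    · exact h.ne rfl
    · exact hab h
    · exact hab h.symm
    · exact h.ne rfl

/-- The rearrangement by which the generator `v` acts. -/
noncomputable def generatorPerm (v : V) : Equiv.Perm (CantorCube n) :=
  pushPop (pairCoordinates Γ e v) (pairLetters e v) (signCoordinate_notMem Γ e v v)

/-- The action of the right-angled Artin group by rearrangements. -/
noncomputable def artinAction : RightAngledArtinGroup Γ →* Equiv.Perm (CantorCube n) :=
  PresentedGroup.toGroup (f := generatorPerm Γ e) (by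
    rintro r ⟨v, w, h, rfl⟩
    have := (actsOnCoordinates_signedPushPop _ (pairLetters e v) (signCoordinate_notMem Γ e v v)
      true).commute (actsOnCoordinates_signedPushPop _ (pairLetters e w)
        (signCoordinate_notMem Γ e w w) true) (disjoint_coordinates Γ e h)
    simp only [map_mul, map_inv, FreeGroup.lift_apply_of]
    rw [mul_inv_eq_one, mul_inv_eq_iff_eq_mul]
    exact this)

theorem artinAction_of (v : V) :
    artinAction Γ e (PresentedGroup.of v) = generatorPerm Γ e v :=
  PresentedGroup.toGroup.of _

theorem artinAction_letter (v : V) (s : Bool) :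
    artinAction Γ e (RightAngledArtinGroup.letter Γ (v, s)) =
      signedPushPop (pairCoordinates Γ e v) (pairLetters e v)
        (signCoordinate_notMem Γ e v v) s := by
  cases s
  · exact (map_inv _ _).trans (congrArg _ (artinAction_of Γ e v))
  · exact artinAction_of Γ e v

theorem artinAction_mem (g : RightAngledArtinGroup Γ) :
    artinAction Γ e g ∈ brinThompsonPerm n := by
  obtain ⟨l, rfl⟩ := RightAngledArtinGroup.exists_prod_letters g
  rw [map_list_prod]
  refine list_prod_mem fun p hp => ?_
  simp only [List.map_map, List.mem_map] at hp
  obtain ⟨⟨v, s⟩, -, rfl⟩ := hp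
  have h := pushPop_mem _ (pairLetters e v) (signCoordinate_notMem Γ e v v)
  rw [Function.comp_apply, artinAction_letter]
  cases s
  · exact inv_mem h
  · exact h

/-- The coordinates of the pairs `(v, v)`. -/
def diagonalCoordinates : Set (Fin n) := {i | ∃ v : V, i = e (some v, some v)}

/-- The words that define the subcube with pairwise disjoint translates. -/
noncomputable def baseWords : Fin n → List Bool :=
  letterWords (diagonalCoordinates e) (fun _ => false) (Letters.base _ _)

theorem apply_of_mem_baseWords {x : CantorCube n} (hx : x ∈ subcube (baseWords e)) (v : V) :
    x (e (some v, some v)) 0 = false :=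
  (eq_lettersAt_iff _ _).1 ((mem_subcube_letterWords _ _).1 hx) _ ⟨v, rfl⟩

theorem artinAction_notMem (g : RightAngledArtinGroup Γ) (hg : g ≠ 1) :
    ∀ x ∈ subcube (baseWords e), artinAction Γ e g x ∉ subcube (baseWords e) := by
  have hdisj (v : V) (s : Bool) (x : CantorCube n) (hx : x ∈ subcube (baseWords e)) :
      x ∉ sink (pairCoordinates Γ e v) (pairLetters e v) (signCoordinate e v) s := by
    intro h
    -- At `(v, v)` the sink requires `true`, while the base subcube has `false`.
    have h1 := h.1 (e (some v, some v)) ⟨v, v, Γ.irrefl, Or.inl rfl, rfl⟩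
    rw [apply_of_mem_baseWords e hx v] at h1
    simp [pairLetters] at h1
  refine RightAngledArtinGroup.pingPong (artinAction Γ e)
    (fun v => sink (pairCoordinates Γ e v) (pairLetters e v) (signCoordinate e v))
    (subcube (baseWords e)) ?_ ?_ ?_ ?_ hdisj g hg
  · intro v s x hx
    rw [artinAction_letter]
    exact signedPushPop_mem_sink _ _ _ (hdisj v _ x hx)
  · intro v s x hx
    rw [artinAction_letter]
    refine signedPushPop_mem_sink _ _ _ fun h => ?_
    have := hx.2.symm.trans h.2
    simp at this
  · intro v w hvw s t x hx
    rw [artinAction_letter]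
    have h1 := (actsOnCoordinates_signedPushPop _ (pairLetters e v)
      (signCoordinate_notMem Γ e v v) s).apply_of_notMem x
    have h2 {i : Fin n} (hi : i ∈ insert (signCoordinate e w) (pairCoordinates Γ e w)) :=
      h1 i ((disjoint_coordinates Γ e hvw).notMem_of_mem_right hi)
    refine ⟨fun i hi => ?_, ?_⟩
    · rw [h2 (Set.mem_insert_of_mem _ hi)]
      exact hx.1 i hi
    · rw [h2 (Set.mem_insert _ _)]
      exact hx.2
  · intro v w hne hvw s t x hx
    rw [artinAction_letter]
    refine signedPushPop_mem_sink _ _ _ fun h => ?_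
    -- At `(v, w)` the sinks of `v` require `true` and those of `w` require `false`.
    have h1 := h.1 (e (some v, some w)) ⟨v, w, hvw, Or.inl rfl, rfl⟩
    rw [hx.1 (e (some v, some w)) ⟨v, w, hvw, Or.inr rfl, rfl⟩] at h1
    simp [pairLetters, hne] at h1

end Action

theorem theorem2 {V : Type*} [Finite V] (Γ : SimpleGraph V) :
    ∃ n : ℕ, 1 ≤ n ∧
      ∃ φ : RestrictedWreathProduct (BrinThompson n) (RightAngledArtinGroup Γ) →* BrinThompson n,
        Function.Injective φ := by
  let e := Finite.equivFin (Option V × Option V)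
  -- The pair `(none, none)` serves only to make the dimension positive when there are no vertices.
  refine ⟨Nat.card (Option V × Option V), Nat.card_pos, ?_⟩
  obtain ⟨φ, hφ⟩ := exists_wreathProduct_hom (ρ := artinAction Γ e)
    (δ := localAction (baseWords e)) (D := subcube (baseWords e)) (brinThompsonPerm _)
    (artinAction_notMem Γ e) (fun h x hx => localAction_of_notMem _ h hx)
    ⟨_, prependCube_mem _ fun _ _ => false⟩ (localAction_injective _) (artinAction_mem Γ e)
    (localAction_letterWords_mem _ _)
  let E := (BrinThompson _).equivMapOfInjective (homeomorphToPerm _)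
    (homeomorphToPerm_injective (CantorCube (Nat.card (Option V × Option V))))
  exact ⟨E.symm.toMonoidHom.comp φ, E.symm.injective.comp hφ⟩
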